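/- **Central Limit Theorem for Regret.** Let $C\subseteq\mathbb{R}^d$ be compact and convex, let $\mathcal Z\subseteq\mathbb{R}^d$ be non-empty and compact, and let $c$ be a random vector with values in $C$ almost surely (so $\mathbb{E}\|c\|^2<\infty$) whose law has a density with respect to Lebesgue measure. Let $\pi^*:C\to\mathcal Z$ be Lebesgue measurable (so $\mathbb{E}\|\pi^*(c)\|^2<\infty$) with $\pi^*(c)\in\arg\min_{z\in\mathcal Z}c^\top z$ almost surely, and suppose that $\pi^*$ is differentiable at $\mathbb{E}[c]$, with Jacobian $\nabla\pi^*(\mathbb{E}[c])$. Define $$\mathrm{Regret}=\mathbb{E}[c^\top\pi^*(c)]-\mathbb{E}[c^\top\pi^*(\mathbb{E}[c])].$$ For i.i.d. copies $c_1,c_2,\dots$ of $c$ put $\bar c_n=\frac1n\sum_{i=1}^n c_i$ and $$\widehat{\mathrm{Regret}}_n=\frac1n\sum_{i=1}^n c_i^\top\pi^*(c_i)-\bar c_n^\top\pi^*(\bar c_n).$$ Let $g(\mathbb{E}[c])=\pi^*(\mathbb{E}[c])+\nabla\pi^*(\mathbb{E}[c])^\top\mathbb{E}[c]$. Then $g(\mathbb{E}[c])$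 is the gradient of $\mu\mapsto\mu^\top\pi^*(\mu)$ at $\mu=\mathbb{E}[c]$, and $$\sqrt n\,\bigl(\widehat{\mathrm{Regret}}_n-\mathrm{Regret}\bigr)\xrightarrow{d}\mathcal N(0,\sigma^2_{\mathrm{regret}}),\qquad \sigma^2_{\mathrm{regret}}=\mathrm{Var}\bigl(c^\top\pi^*(c)-g(\mathbb{E}[c])^\top c\bigr)$$ (where $\mathcal N(0,0)$ is the point mass at $0$). If moreover $\nabla\pi^*(\mathbb{E}[c])=0$ or $\mathbb{E}[c]=0$, then $$\sigma^2_{\mathrm{regret}}=\mathrm{Var}\bigl(c^\top\pi^*(c)\bigr)+\mathrm{Var}\bigl(c^\top\pi^*(\mathbb{E}[c])\bigr)-2\,\mathrm{Cov}\bigl(c^\top\pi^*(c),\,c^\top\pi^*(\mathbb{E}[c])\bigr).$$ -/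

import Mathlib

open MeasureTheory ProbabilityTheory Filter Topology
open scoped InnerProductSpace

noncomputable section

/-- The regret of acting on the mean cost: `E[cᵀ π(c)] - E[cᵀ π(E[c])]`. -/
def expectedRegret {Ω : Type*} [MeasurableSpace Ω] {d : ℕ} (P : Measure Ω)
    (c : Ω → EuclideanSpace ℝ (Fin d))
    (π : EuclideanSpace ℝ (Fin d) → EuclideanSpace ℝ (Fin d)) : ℝ :=
  (∫ ω, ⟪c ω, π (c ω)⟫_ℝ ∂P) - ∫ ω, ⟪c ω, π (∫ ω', c ω' ∂P)⟫_ℝ ∂P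

/-- The sample mean `c̄ = (1/n) ∑ cᵢ` of the first `n` observations. -/
def sampleMean {Ω : Type*} {d : ℕ} (X : ℕ → Ω → EuclideanSpace ℝ (Fin d)) (n : ℕ) (ω : Ω) :
    EuclideanSpace ℝ (Fin d) :=
  (n : ℝ)⁻¹ • ∑ i ∈ Finset.range n, X i ω

/-- The plug-in estimator `(1/n) ∑ cᵢᵀ π(cᵢ) - c̄ᵀ π(c̄)` of the regret. -/
def regretEstimator {Ω : Type*} {d : ℕ}
    (π : EuclideanSpace ℝ (Fin d) → EuclideanSpace ℝ (Fin d))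
    (X : ℕ → Ω → EuclideanSpace ℝ (Fin d)) (n : ℕ) (ω : Ω) : ℝ :=
  (n : ℝ)⁻¹ * ∑ i ∈ Finset.range n, ⟪X i ω, π (X i ω)⟫_ℝ
    - ⟪sampleMean X n ω, π (sampleMean X n ω)⟫_ℝ

/-- The vector `g(m) = π(m) + ∇π(m)ᵀ m`, where `∇π(m)` is the Jacobian. -/
def regretGradient {d : ℕ} (π : EuclideanSpace ℝ (Fin d) → EuclideanSpace ℝ (Fin d))
    (m : EuclideanSpace ℝ (Fin d)) : EuclideanSpace ℝ (Fin d) :=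
  π m + (fderiv ℝ π m).adjoint m

/-- The asymptotic variance `Var(cᵀ π(c) - g(E[c])ᵀ c)`. -/
def regretVariance {Ω : Type*} [MeasurableSpace Ω] {d : ℕ} (P : Measure Ω)
    (c : Ω → EuclideanSpace ℝ (Fin d))
    (π : EuclideanSpace ℝ (Fin d) → EuclideanSpace ℝ (Fin d)) : ℝ :=
  variance (fun ω => ⟪c ω, π (c ω)⟫_ℝ - ⟪regretGradient π (∫ ω', c ω' ∂P), c ω⟫_ℝ) P

/-- The cost vector `c` takes values in the compact convex set `C` almost surely, is square
integrable, and its law has a density with respect to Lebesgue measure. -/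
structure IsCostVector {Ω : Type*} [MeasurableSpace Ω] {d : ℕ} (P : Measure Ω)
    (C : Set (EuclideanSpace ℝ (Fin d))) (c : Ω → EuclideanSpace ℝ (Fin d)) : Prop where
  isCompact : IsCompact C
  convex : Convex ℝ C
  mem : ∀ᵐ ω ∂P, c ω ∈ C
  memLp : MemLp c 2 P
  absolutelyContinuous : P.map c ≪ volume

/-- `π : C → Z` is an optimal decision function: it is (Lebesgue) measurable, `π(c)` is square
integrable, and `π(c)` minimizes `cᵀ z` over `z ∈ Z` for almost every realization of `c`.
The map `π` is totalized; only its values on `C` are constrained. -/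
structure IsDecisionFunction {Ω : Type*} [MeasurableSpace Ω] {d : ℕ} (P : Measure Ω)
    (C Z : Set (EuclideanSpace ℝ (Fin d))) (c : Ω → EuclideanSpace ℝ (Fin d))
    (π : EuclideanSpace ℝ (Fin d) → EuclideanSpace ℝ (Fin d)) : Prop where
  mapsTo : Set.MapsTo π C Z
  aemeasurable : AEMeasurable π (volume.restrict C)
  memLp : MemLp (fun ω => π (c ω)) 2 P
  optimal : ∀ᵐ ω ∂P, IsMinOn (fun z => ⟪c ω, z⟫_ℝ) Z (π (c ω))

end

/-! This is the delta method. Let m = E[c] and let g be the gradient of μ ↦ μᵀπ(μ) at m. Linearizing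
c̄ₙᵀπ(c̄ₙ) at m turns the scaled error into the normalized centred sum of the i.i.d. variables
cᵢᵀπ(cᵢ) - gᵀcᵢ, minus √n times a Taylor remainder at c̄ₙ (`sqrt_mul_regretEstimator_sub`). The sum
obeys the classical CLT. The remainder is o(‖c̄ₙ - m‖) and n E‖c̄ₙ - m‖² is constant, so it vanishes
in probability, and Slutsky's theorem concludes. The density and convexity serve measurability: π is
measurable on C only up to Lebesgue null sets, so π(c̄ₙ) is controlled because c̄ₙ lies in C and has
a density. -/

open Asymptotics

/-! ### Sample mean: density and second moments -/

section SampleMean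

variable {Ω : Type*} [MeasurableSpace Ω] {P : Measure Ω} [IsProbabilityMeasure P] {d : ℕ}
  {c : Ω → EuclideanSpace ℝ (Fin d)} {X : ℕ → Ω → EuclideanSpace ℝ (Fin d)}

omit [IsProbabilityMeasure P] in
theorem aemeasurable_sampleMean (hX : ∀ i, AEMeasurable (X i) P) (n : ℕ) :
    AEMeasurable (sampleMean X n) P := by
  unfold sampleMean
  exact (Finset.aemeasurable_fun_sum _ fun i _ => hX i).const_smul (n : ℝ)⁻¹

/-- A sum of at least one independent summands with a density has a density. -/
theorem map_sum_range_succ_absolutelyContinuous (hX : ∀ i, AEMeasurable (X i) P)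
    (hind : iIndepFun X P) (hac : ∀ i, P.map (X i) ≪ volume) (n : ℕ) :
    P.map (∑ i ∈ Finset.range (n + 1), X i) ≪ volume := by
  rw [Finset.sum_range_succ, IndepFun.map_add_eq_map_conv_map₀
    (Finset.aemeasurable_sum _ fun i _ => hX i) (hX n) (hind.indepFun_sum_range_succ₀ hX n)]
  -- A density for the last summand suffices, so no induction is needed.
  exact Measure.conv_absolutelyContinuous (hac n)

theorem map_sampleMean_absolutelyContinuous (hX : ∀ i, AEMeasurable (X i) P)
    (hind : iIndepFun X P) (hac : ∀ i, P.map (X i) ≪ volume) {n : ℕ} (hn : n ≠ 0) :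
    P.map (sampleMean X n) ≪ volume := by
  obtain ⟨k, rfl⟩ := Nat.exists_eq_succ_of_ne_zero hn
  have hr : ((k.succ : ℕ) : ℝ)⁻¹ ≠ 0 := by positivity
  have h1 : sampleMean X k.succ =
      (fun x => ((k.succ : ℕ) : ℝ)⁻¹ • x) ∘ (∑ i ∈ Finset.range (k + 1), X i) := by
    ext ω : 1
    simp [sampleMean]
  have hm : Measurable fun x : EuclideanSpace ℝ (Fin d) => ((k.succ : ℕ) : ℝ)⁻¹ • x := by fun_prop
  rw [h1, ← AEMeasurable.map_map_of_aemeasurable hm.aemeasurable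
    (Finset.aemeasurable_sum _ fun i _ => hX i)]
  refine ((map_sum_range_succ_absolutelyContinuous hX hind hac k).map hm).trans ?_
  rw [Measure.map_addHaar_smul volume hr]
  exact Measure.smul_absolutelyContinuous

omit [MeasurableSpace Ω] in
theorem sampleMean_mem {C : Set (EuclideanSpace ℝ (Fin d))} (hC : Convex ℝ C)
    {n : ℕ} (hn : n ≠ 0) {ω : Ω} (h : ∀ i, X i ω ∈ C) : sampleMean X n ω ∈ C := by
  rw [sampleMean, Finset.smul_sum]
  exact hC.sum_mem (fun _ _ => by positivity) (by simp [hn]) fun i _ => h i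

omit [IsProbabilityMeasure P] in
theorem integral_apply_euclideanSpace (hc : Integrable c P) (j : Fin d) :
    ∫ ω, c ω j ∂P = (∫ ω, c ω ∂P) j :=
  (EuclideanSpace.proj (𝕜 := ℝ) j).integral_comp_comm hc

/-- The sample mean is unbiased, so the integral is its variance, and variances of independent
summands add. -/
theorem integral_sampleMean_apply_sub_sq (hc : MemLp c 2 P) (hind : iIndepFun X P)
    (hid : ∀ i, IdentDistrib (X i) c P P) {n : ℕ} (hn : n ≠ 0) (j : Fin d) :
    n * ∫ ω, (sampleMean X n ω j - (∫ ω', c ω' ∂P) j) ^ 2 ∂P = Var[fun ω => c ω j; P] := by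
  have hn' : (n : ℝ) ≠ 0 := by exact_mod_cast hn
  have hproj : Measurable fun x : EuclideanSpace ℝ (Fin d) => x j := by fun_prop
  have hid' i : IdentDistrib (fun ω => X i ω j) (fun ω => c ω j) P P := (hid i).comp hproj
  have hcj : MemLp (fun ω => c ω j) 2 P := (EuclideanSpace.proj (𝕜 := ℝ) j).comp_memLp' hc
  have hXj i : MemLp (fun ω => X i ω j) 2 P := (hid' i).memLp_iff.2 hcj
  have hS : (fun ω => sampleMean X n ω j) =
      fun ω => (n : ℝ)⁻¹ * (∑ i ∈ Finset.range n, fun ω => X i ω j) ω := by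
    ext ω
    simp [sampleMean]
  have hmean : ∫ ω, sampleMean X n ω j ∂P = (∫ ω', c ω' ∂P) j := by
    rw [hS, integral_const_mul]
    simp only [Finset.sum_apply]
    rw [integral_finsetSum _ fun i _ => (hXj i).integrable (by norm_num)]
    simp only [(hid' _).integral_eq]
    rw [integral_apply_euclideanSpace (hc.integrable (by norm_num))]
    simp [hn']
  have hmeas : AEMeasurable (fun ω => sampleMean X n ω j) P :=
    hproj.comp_aemeasurable (aemeasurable_sampleMean (fun i => (hid i).aemeasurable_fst) n)
  rw [← hmean, ← variance_eq_integral hmeas, hS, variance_const_mul,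
    IndepFun.variance_sum (fun i _ => hXj i)
      (fun i _ k _ hik => (hind.indepFun hik).comp hproj hproj)]
  simp only [(hid' _).variance_eq]
  simp
  field_simp

omit [IsProbabilityMeasure P] in
theorem memLp_sampleMean (hc : MemLp c 2 P) (hid : ∀ i, IdentDistrib (X i) c P P) (n : ℕ) :
    MemLp (sampleMean X n) 2 P := by
  unfold sampleMean
  exact (memLp_finsetSum _ fun i _ => (hid i).memLp_iff.2 hc).const_smul (n : ℝ)⁻¹

theorem integrable_norm_sampleMean_sub_sq (hc : MemLp c 2 P)
    (hid : ∀ i, IdentDistrib (X i) c P P) (n : ℕ) (m : EuclideanSpace ℝ (Fin d)) :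
    Integrable (fun ω => ‖sampleMean X n ω - m‖ ^ 2) P :=
  ((memLp_sampleMean hc hid n).sub (memLp_const m)).integrable_norm_pow (by norm_num)

/-- The mean squared deviation of the sample mean decays like `1 / n`. -/
theorem integral_norm_sampleMean_sub_sq (hc : MemLp c 2 P) (hind : iIndepFun X P)
    (hid : ∀ i, IdentDistrib (X i) c P P) {n : ℕ} (hn : n ≠ 0) :
    n * ∫ ω, ‖sampleMean X n ω - ∫ ω', c ω' ∂P‖ ^ 2 ∂P = ∑ j, Var[fun ω => c ω j; P] := by
  have hL : MemLp (fun ω => sampleMean X n ω - ∫ ω', c ω' ∂P) 2 P :=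
    (memLp_sampleMean hc hid n).sub (memLp_const _)
  simp only [EuclideanSpace.real_norm_sq_eq]
  rw [integral_finsetSum _ fun j _ =>
    MemLp.integrable_sq (f := fun ω => (sampleMean X n ω - ∫ ω', c ω' ∂P) j)
      ((EuclideanSpace.proj (𝕜 := ℝ) j).comp_memLp' hL), Finset.mul_sum]
  exact Finset.sum_congr rfl fun j _ => integral_sampleMean_apply_sub_sq hc hind hid hn j

end SampleMean

/-- If `n ‖Tₙ - m‖²` has bounded expectation and `r (x) = o(x - m)` at `m`, then
`√n r (Tₙ)` converges to zero in probability. -/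
theorem tendstoInMeasure_sqrt_mul_of_isLittleO {Ω E : Type*} [MeasurableSpace Ω] {P : Measure Ω}
    [IsFiniteMeasure P] [NormedAddCommGroup E] {T : ℕ → Ω → E} {m : E} {V : ℝ} {r : E → ℝ}
    (hint : ∀ n, Integrable (fun ω => ‖T n ω - m‖ ^ 2) P)
    (hV : ∀ n, n ≠ 0 → n * ∫ ω, ‖T n ω - m‖ ^ 2 ∂P ≤ V)
    (hr : r =o[𝓝 m] fun x => x - m) :
    TendstoInMeasure P (fun (n : ℕ) ω => √(n : ℝ) * r (T n ω)) atTop 0 := by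
  have hV0 : 0 ≤ V := le_trans (by positivity) (hV 1 one_ne_zero)
  have markov : ∀ n : ℕ, n ≠ 0 → ∀ a : ℝ, 0 < a →
      P.real {ω | a ≤ ‖T n ω - m‖ ^ 2} ≤ V / (n * a) := by
    intro n hn a ha
    have hn' : (0 : ℝ) < n := by exact_mod_cast hn.bot_lt
    have h := mul_meas_ge_le_integral_of_nonneg
      (Eventually.of_forall fun ω => by positivity) (hint n) a
    rw [le_div_iff₀ (by positivity)]
    calc _ = n * (a * P.real {ω | a ≤ ‖T n ω - m‖ ^ 2}) := by ring
      _ ≤ n * ∫ ω, ‖T n ω - m‖ ^ 2 ∂P := by gcongr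
      _ ≤ V := hV n hn
  rw [tendstoInMeasure_iff_measureReal_norm]
  intro ε hε
  rw [Metric.tendsto_atTop]
  intro κ hκ
  -- `V * η ^ 2 / ε ^ 2` is the Markov bound for the second event of `hsub`. It does not depend on
  -- `n`, so `η` can be fixed before `δ` and `N`.
  obtain ⟨η, hη, hηκ⟩ : ∃ η : ℝ, 0 < η ∧ V * η ^ 2 / ε ^ 2 < κ / 2 := by
    have : Tendsto (fun η : ℝ => V * η ^ 2 / ε ^ 2) (𝓝[>] 0) (𝓝 0) := by
      have : Continuous fun η : ℝ => V * η ^ 2 / ε ^ 2 := by fun_prop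
      simpa using (this.tendsto 0).mono_left nhdsWithin_le_nhds
    obtain ⟨η, h1, h2⟩ := ((this.eventually_lt_const (half_pos hκ)).and
      self_mem_nhdsWithin).exists
    exact ⟨η, h2, h1⟩
  obtain ⟨δ, hδ, hball⟩ := Metric.eventually_nhds_iff.1 (hr.def hη)
  have hlim : Tendsto (fun n : ℕ => V / (n * δ ^ 2)) atTop (𝓝 0) :=
    tendsto_const_nhds.div_atTop
      (tendsto_natCast_atTop_atTop.atTop_mul_const (by positivity))
  obtain ⟨N, hN⟩ := eventually_atTop.1 (hlim.eventually_lt_const (half_pos hκ))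
  refine ⟨max N 1, fun n hn => ?_⟩
  have hn0 : n ≠ 0 := by have := (le_max_right N 1).trans hn; omega
  have hn' : (0 : ℝ) < n := by exact_mod_cast hn0.bot_lt
  -- Either `T n ω` is at least `δ` away from `m`, or `|r| ≤ η ‖T - m‖` holds there and a large `√n
  -- * r` forces a large deviation.
  have hsub : {ω | ε ≤ ‖√(n : ℝ) * r (T n ω) - (0 : Ω → ℝ) ω‖} ⊆
      {ω | δ ^ 2 ≤ ‖T n ω - m‖ ^ 2} ∪ {ω | ε ^ 2 / (n * η ^ 2) ≤ ‖T n ω - m‖ ^ 2} := by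
    intro ω hω
    by_cases hd : δ ≤ ‖T n ω - m‖
    · exact Or.inl (by simp only [Set.mem_ofPred_eq]; gcongr)
    right
    have hb := hball (y := T n ω) (by rw [dist_eq_norm]; exact not_le.1 hd)
    simp only [Set.mem_ofPred_eq, Pi.zero_apply, sub_zero, norm_mul,
      Real.norm_of_nonneg (Real.sqrt_nonneg _)] at hω ⊢
    have h1 : ε ≤ √(n : ℝ) * (η * ‖T n ω - m‖) := hω.trans (by gcongr)
    have h2 : ε ^ 2 ≤ (√(n : ℝ) * (η * ‖T n ω - m‖)) ^ 2 := by gcongr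
    rw [mul_pow, mul_pow, Real.sq_sqrt hn'.le] at h2
    rw [div_le_iff₀ (by positivity)]
    linarith
  rw [Real.dist_0_eq_abs, abs_of_nonneg measureReal_nonneg]
  calc _ ≤ _ := measureReal_mono hsub
    _ ≤ _ := measureReal_union_le _ _
    _ ≤ V / (n * δ ^ 2) + V / (n * (ε ^ 2 / (n * η ^ 2))) :=
      add_le_add (markov n hn0 _ (by positivity)) (markov n hn0 _ (by positivity))
    _ = V / (n * δ ^ 2) + V * η ^ 2 / ε ^ 2 := by field_simp
    _ < κ := by linarith [hN n ((le_max_left N 1).trans hn)]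

/-! ### Decision function and limit theorem -/

section Decision

variable {Ω : Type*} [MeasurableSpace Ω] {P : Measure Ω} {d : ℕ}
  {C Z : Set (EuclideanSpace ℝ (Fin d))} {c : Ω → EuclideanSpace ℝ (Fin d)}
  {π : EuclideanSpace ℝ (Fin d) → EuclideanSpace ℝ (Fin d)}

/-- Product rule; the adjoint moves the Jacobian from the direction onto `m`. -/
theorem hasGradientAt_inner_self {m : EuclideanSpace ℝ (Fin d)} (hπ : DifferentiableAt ℝ π m) :
    HasGradientAt (fun μ => ⟪μ, π μ⟫_ℝ) (regretGradient π m) m := by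
  rw [hasGradientAt_iff_hasFDerivAt]
  refine ((hasFDerivAt_id m).inner ℝ hπ.hasFDerivAt).congr_fderiv ?_
  ext v
  simp [regretGradient, ContinuousLinearMap.adjoint_inner_left,
    real_inner_comm, add_comm]

theorem IsCostVector.map_absolutelyContinuous_restrict (hc : IsCostVector P C c)
    {Y : Ω → EuclideanSpace ℝ (Fin d)} (hY : AEMeasurable Y P) (hYC : ∀ᵐ ω ∂P, Y ω ∈ C)
    (hac : P.map Y ≪ volume) : P.map Y ≪ volume.restrict C := by
  have hC : MeasurableSet C := hc.isCompact.measurableSet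
  have h : (P.map Y).restrict C = P.map Y :=
    Measure.restrict_eq_self_of_ae_mem ((ae_map_iff hY hC).2 hYC)
  rw [← h]
  exact hac.restrict C

theorem IsCostVector.memLp_inner_decision [IsProbabilityMeasure P] (hc : IsCostVector P C c)
    (hZ : IsCompact Z) (hπ : IsDecisionFunction P C Z c π) :
    MemLp (fun ω => ⟪c ω, π (c ω)⟫_ℝ) 2 P := by
  obtain ⟨A, hA⟩ := hc.isCompact.isBounded.exists_norm_le
  obtain ⟨B, hB⟩ := hZ.isBounded.exists_norm_le
  refine MemLp.of_bound (hc.memLp.1.inner hπ.memLp.1) (A * B) ?_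
  filter_upwards [hc.mem] with ω hω
  exact (norm_inner_le_norm _ _).trans (mul_le_mul (hA _ hω) (hB _ (hπ.mapsTo hω))
    (norm_nonneg _) ((norm_nonneg _).trans (hA _ hω)))

/-- The hypothesis covers both special cases, zero Jacobian and zero mean: either way the gradient
reduces to π(m). -/
theorem regretVariance_eq_of_adjoint_eq_zero [IsProbabilityMeasure P] (hc : IsCostVector P C c)
    (hZ : IsCompact Z) (hπ : IsDecisionFunction P C Z c π)
    (h : (fderiv ℝ π (∫ ω, c ω ∂P)).adjoint (∫ ω, c ω ∂P) = 0) :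
    regretVariance P c π =
      variance (fun ω => ⟪c ω, π (c ω)⟫_ℝ) P
        + variance (fun ω => ⟪c ω, π (∫ ω', c ω' ∂P)⟫_ℝ) P
        - 2 * covariance (fun ω => ⟪c ω, π (c ω)⟫_ℝ)
            (fun ω => ⟪c ω, π (∫ ω', c ω' ∂P)⟫_ℝ) P := by
  have hg : regretGradient π (∫ ω, c ω ∂P) = π (∫ ω, c ω ∂P) := by
    rw [regretGradient, h, add_zero]
  simp only [regretVariance, hg, real_inner_comm (c _) (π (∫ ω, c ω ∂P))]
  rw [variance_fun_sub (hc.memLp_inner_decision hZ hπ) (hc.memLp.inner_const _)]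
  ring

/-- The error of linearizing the estimator at the mean is the first-order Taylor remainder of
`μ ↦ μᵀ π(μ)` at the sample mean. -/
theorem sqrt_mul_regretEstimator_sub [IsProbabilityMeasure P] (hc : Integrable c P)
    (hcπ : Integrable (fun ω => ⟪c ω, π (c ω)⟫_ℝ) P)
    (X : ℕ → Ω → EuclideanSpace ℝ (Fin d)) (g : EuclideanSpace ℝ (Fin d)) (n : ℕ) (ω : Ω) :
    √(n : ℝ) * (regretEstimator π X n ω - expectedRegret P c π) =
      (√(n : ℝ))⁻¹ * (∑ i ∈ Finset.range n, (⟪X i ω, π (X i ω)⟫_ℝ - ⟪g, X i ω⟫_ℝ)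
          - n * ∫ ω, (⟪c ω, π (c ω)⟫_ℝ - ⟪g, c ω⟫_ℝ) ∂P)
        - √(n : ℝ) * (⟪sampleMean X n ω, π (sampleMean X n ω)⟫_ℝ
            - ⟪∫ ω, c ω ∂P, π (∫ ω, c ω ∂P)⟫_ℝ - ⟪g, sampleMean X n ω - ∫ ω, c ω ∂P⟫_ℝ) := by
  rcases eq_or_ne n 0 with rfl | hn
  · simp
  have hn' : (0 : ℝ) < n := by exact_mod_cast hn.bot_lt
  have h1 : ∫ ω, ⟪g, c ω⟫_ℝ ∂P = ⟪g, ∫ ω, c ω ∂P⟫_ℝ := integral_inner hc g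
  have h2 : ∫ ω, ⟪c ω, π (∫ ω, c ω ∂P)⟫_ℝ ∂P = ⟪∫ ω, c ω ∂P, π (∫ ω, c ω ∂P)⟫_ℝ := by
    simp only [real_inner_comm (π (∫ ω, c ω ∂P))]
    exact integral_inner hc _
  have h3 : ⟪g, sampleMean X n ω⟫_ℝ = (n : ℝ)⁻¹ * ∑ i ∈ Finset.range n, ⟪g, X i ω⟫_ℝ := by
    rw [sampleMean, inner_smul_right, inner_sum]
  have h4 : (√(n : ℝ))⁻¹ = √(n : ℝ) * (n : ℝ)⁻¹ := by
    rw [← div_eq_mul_inv, Real.sqrt_div_self]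
  rw [integral_sub hcπ (hc.const_inner g), h1, inner_sub_right, h3, regretEstimator,
    expectedRegret, h2, Finset.sum_sub_distrib, h4]
  field_simp
  ring

theorem tendstoInDistribution_regretEstimator [IsProbabilityMeasure P] (hc : IsCostVector P C c)
    (hZ : IsCompact Z) (hπ : IsDecisionFunction P C Z c π)
    (hπ_diff : DifferentiableAt ℝ π (∫ ω, c ω ∂P)) {X : ℕ → Ω → EuclideanSpace ℝ (Fin d)}
    (hind : iIndepFun X P) (hid : ∀ i, IdentDistrib (X i) c P P) :
    TendstoInDistribution
      (fun (n : ℕ) ω => √(n : ℝ) * (regretEstimator π X n ω - expectedRegret P c π))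
      atTop (id : ℝ → ℝ) (fun _ => P)
      (gaussianReal 0 (regretVariance P c π).toNNReal) := by
  set m := ∫ ω, c ω ∂P with hm
  set g := regretGradient π m with hg
  have hcint : Integrable c P := hc.memLp.integrable (by norm_num)
  have hX i : AEMeasurable (X i) P := (hid i).aemeasurable_fst
  have hXac i : P.map (X i) ≪ volume := (hid i).map_eq ▸ hc.absolutelyContinuous
  have hXC : ∀ᵐ ω ∂P, ∀ i, X i ω ∈ C := ae_all_iff.2 fun i =>
    (hid i).symm.ae_snd hc.isCompact.measurableSet hc.mem
  have hπX i : AEMeasurable π (P.map (X i)) := hπ.aemeasurable.mono_ac <|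
    hc.map_absolutelyContinuous_restrict (hX i) (hXC.mono fun _ h => h i) (hXac i)
  have hcπ := hc.memLp_inner_decision hZ hπ
  let φ : EuclideanSpace ℝ (Fin d) → ℝ := fun x => ⟪x, π x⟫_ℝ - ⟪g, x⟫_ℝ
  have hφ i : AEMeasurable φ (P.map (X i)) :=
    (aemeasurable_id.inner (hπX i)).sub (by fun_prop)
  have hWid i : IdentDistrib (φ ∘ X i) (φ ∘ c) P P := (hid i).comp_of_aemeasurable (hφ i)
  have hWind : iIndepFun (fun i => φ ∘ X i) P := hind.comp₀ (fun _ => φ) hX hφ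
  have hW : MemLp (φ ∘ c) 2 P := hcπ.sub (hc.memLp.const_inner g)
  have hclt := tendstoInDistribution_inv_sqrt_mul_sum_sub (P := P) (X := fun i => φ ∘ X i)
    (P' := gaussianReal 0 (regretVariance P c π).toNNReal) (Y := id)
    ⟨aemeasurable_id, by rw [(hWid 0).variance_eq, Measure.map_id]; rfl⟩
    ((hWid 0).memLp_iff.2 hW) hWind (fun i => (hWid i).trans (hWid 0).symm)
  rw [(hWid 0).integral_eq] at hclt
  have hdecomp := sqrt_mul_regretEstimator_sub hcint (hcπ.integrable (by norm_num)) X g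
  refine tendstoInDistribution_of_tendstoInMeasure_sub _ _ hclt ?_ fun n => ?_
  · have hr := tendstoInMeasure_sqrt_mul_of_isLittleO (V := ∑ j, Var[fun ω => c ω j; P])
      (integrable_norm_sampleMean_sub_sq hc.memLp hid · m)
      (fun n hn => (integral_norm_sampleMean_sub_sq hc.memLp hind hid hn).le)
      (hasGradientAt_iff_isLittleO.1 (hasGradientAt_inner_self hπ_diff))
    rw [tendstoInMeasure_iff_norm] at hr ⊢
    convert hr using 8 with ε hε n ω
    rw [Pi.sub_apply, Pi.sub_apply, hdecomp n ω, ← norm_neg]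
    congr 1
    simp only [Pi.zero_apply, sub_zero, φ, Function.comp_apply]
    ring
  · rcases eq_or_ne n 0 with rfl | hn
    -- The empty sample mean is 0, which need not lie in `C` and has no density in general, but the
    -- factor √0 makes the statistic vanish.
    · simp
    have hT := aemeasurable_sampleMean hX n
    have hTC : ∀ᵐ ω ∂P, sampleMean X n ω ∈ C := hXC.mono fun _ h => sampleMean_mem hc.convex hn h
    have hπT : AEMeasurable (fun ω => π (sampleMean X n ω)) P :=
      (hπ.aemeasurable.mono_ac (hc.map_absolutelyContinuous_restrict hT hTC
        (map_sampleMean_absolutelyContinuous hX hind hXac hn))).comp_aemeasurable hT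
    have hS : AEMeasurable (fun ω => ∑ i ∈ Finset.range n, ⟪X i ω, π (X i ω)⟫_ℝ) P :=
      Finset.aemeasurable_fun_sum _ fun i _ => (hX i).inner ((hπX i).comp_aemeasurable (hX i))
    exact (((hS.const_mul _).sub (hT.inner hπT)).sub_const _).const_mul _

end Decision

theorem theorem3p13 {Ω : Type*} [MeasurableSpace Ω] (P : Measure Ω) [IsProbabilityMeasure P]
    (d : ℕ) (C Z : Set (EuclideanSpace ℝ (Fin d)))
    (c : Ω → EuclideanSpace ℝ (Fin d)) (hc : IsCostVector P C c)
    (hZ_nonempty : Z.Nonempty) (hZ_compact : IsCompact Z)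
    (π : EuclideanSpace ℝ (Fin d) → EuclideanSpace ℝ (Fin d))
    (hπ : IsDecisionFunction P C Z c π)
    (hπ_diff : DifferentiableAt ℝ π (∫ ω, c ω ∂P))
    (X : ℕ → Ω → EuclideanSpace ℝ (Fin d))
    (hX_indep : iIndepFun X P) (hX_ident : ∀ i, IdentDistrib (X i) c P P) :
    HasGradientAt (fun μ => ⟪μ, π μ⟫_ℝ) (regretGradient π (∫ ω, c ω ∂P)) (∫ ω, c ω ∂P) ∧
    TendstoInDistribution
      (fun (n : ℕ) ω => √(n : ℝ) * (regretEstimator π X n ω - expectedRegret P c π))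
      atTop (id : ℝ → ℝ) (fun _ => P)
      (gaussianReal 0 (regretVariance P c π).toNNReal) ∧
    ((fderiv ℝ π (∫ ω, c ω ∂P) = 0 ∨ ∫ ω, c ω ∂P = 0) →
      regretVariance P c π =
        variance (fun ω => ⟪c ω, π (c ω)⟫_ℝ) P
          + variance (fun ω => ⟪c ω, π (∫ ω', c ω' ∂P)⟫_ℝ) P
          - 2 * covariance (fun ω => ⟪c ω, π (c ω)⟫_ℝ)
              (fun ω => ⟪c ω, π (∫ ω', c ω' ∂P)⟫_ℝ) P) := by
  refine ⟨hasGradientAt_inner_self hπ_diff,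
    tendstoInDistribution_regretEstimator hc hZ_compact hπ hπ_diff hX_indep hX_ident, fun h => ?_⟩
  refine regretVariance_eq_of_adjoint_eq_zero hc hZ_compact hπ ?_
  rcases h with h | h <;> simp [h]
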